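/- A curve in $\mathbb{R}^d$ is given by a continuous map $f:[0,1]\to\mathbb{R}^d$ (up to reparametrization); write $\mathcal{C}$ for its image, and assume that $\mathcal{C}$ is not a single point. Fix a macroscopic scale $L_o>0$ and a shrinkage factor $\gamma>1$, and put $L_k=\gamma^{-k}L_o$ for $k=0,1,2,\dots$. A *straight run* of the curve at scale $L=L_k$ is a segment $f([a,b])$, $0\le a\le b\le 1$, with $|f(a)-f(b)|=L$, which is contained in the closed solid circular cylinder of length $L$ and cross-sectional diameter $(9/\sqrt{\gamma})\,L$ whose two faces are centred at $f(a)$ and $f(b)$. A collection of straight runs at scales $L_{k_1}>\dots>L_{k_n}$ is *nested* if, for any two of its runs, the cylinder of the run at the larger scale contains the other run. For an integer $k_o\ge 0$, the straight runs of the curve are *$(\gamma,k_o)$-sparse* (with macroscopic scale $L_o$) if the curve does not exhibit any nested collection of straight runs on a sequence of scales $L_{k_1}>\dots>L_{k_n}$, $n\ge 1$, with $n\ge\frac12\max\{k_n,k_o\}$. **Theorem.** Let the curve be as above. 1. If its straight runs are $(\gamma,k_o)$-sparse, for some $L_o>0$ and some integer $k_o\ge0$, and $m\ge 1$ is an integer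 strictly smaller than $\gamma$, then $\dim_{\mathcal H}\mathcal{C}\ge s$, where $s$ is given by $\gamma^s=\sqrt{m(m+1)}$. 2. In particular, if $m\ge 2$ is an integer such that for every $\gamma>m$ there are $L_o>0$ and an integer $k_o\ge0$ (both may depend on $\gamma$) for which the straight runs of the curve are $(\gamma,k_o)$-sparse, then $$\dim_{\mathcal H}\mathcal{C}\ \ge\ 1+\frac{\ln(1+1/m)}{2\ln m}.$$ -/

import Mathlib

/-- The closed solid right circular cylinder in `ℝ^d` whose two faces are centred at `x` and `y`
(so its length is `dist x y`) and whose cross sections have diameter `w`: the points `p` that lie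
at distance at most `w / 2` from a point `c` of the axis segment `[x, y]`, in the direction
orthogonal to the axis. -/
def cylinder {d : ℕ} (x y : EuclideanSpace ℝ (Fin d)) (w : ℝ) :
    Set (EuclideanSpace ℝ (Fin d)) :=
  {p | ∃ c ∈ segment ℝ x y, inner ℝ (p - c) (y - x) = 0 ∧ dist p c ≤ w / 2}

/-- The length scale `L_k = γ^{-k} L₀`. -/
noncomputable def lengthScale (γ L₀ : ℝ) (k : ℕ) : ℝ := L₀ / γ ^ k

/-- The cylinder that belongs to a straight run at scale `L` from the point `f a` to the point
`f b` of the curve: faces centred at these two points, cross sectional diameter `(9 / √γ) L`. -/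
noncomputable def runCylinder {d : ℕ} (f : C(unitInterval, EuclideanSpace ℝ (Fin d)))
    (γ L : ℝ) (a b : unitInterval) : Set (EuclideanSpace ℝ (Fin d)) :=
  cylinder (f a) (f b) (9 / √γ * L)

/-- The segment of the curve `f` between the parameters `a ≤ b` is a straight run at scale `L`:
it traverses, in the length direction and joining the centres of the two faces, a cylinder of
length `L` and cross sectional diameter `(9 / √γ) L`.
Reparametrizing or reversing `f` does not change which segments are straight runs. -/
def IsStraightRun {d : ℕ} (f : C(unitInterval, EuclideanSpace ℝ (Fin d)))
    (γ L : ℝ) (a b : unitInterval) : Prop :=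
  a ≤ b ∧ dist (f a) (f b) = L ∧ f '' Set.Icc a b ⊆ runCylinder f γ L a b

/-- `f` exhibits a nested collection of straight runs at the scales `L_{k 0} > ⋯ > L_{k n}`
(`n + 1` runs): of any two of the runs, the cylinder of the one at the larger scale
contains the other run. -/
def ExhibitsNestedRuns {d : ℕ} (f : C(unitInterval, EuclideanSpace ℝ (Fin d)))
    (γ L₀ : ℝ) {n : ℕ} (k : Fin (n + 1) → ℕ) : Prop :=
  ∃ a b : Fin (n + 1) → unitInterval,
    (∀ i, IsStraightRun f γ (lengthScale γ L₀ (k i)) (a i) (b i)) ∧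
    ∀ i j, i < j →
      f '' Set.Icc (a j) (b j) ⊆ runCylinder f γ (lengthScale γ L₀ (k i)) (a i) (b i)

/-- The straight runs of `f` are `(γ, k₀)`-sparse down to the scale `ℓ` (with macroscopic scale
`L₀`): there is no nested collection of straight runs at scales `L_{k 0} > ⋯ > L_{k n}`,
`L_{k n} ≥ ℓ`, whose number `n + 1` is at least `max (k n) k₀ / 2`. -/
def StraightRunsSparseDownTo {d : ℕ} (f : C(unitInterval, EuclideanSpace ℝ (Fin d)))
    (γ L₀ : ℝ) (k₀ : ℕ) (ℓ : ℝ) : Prop :=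
  ∀ (n : ℕ) (k : Fin (n + 1) → ℕ), StrictMono k →
    ℓ ≤ lengthScale γ L₀ (k (Fin.last n)) →
    (1 / 2 : ℝ) * max (k (Fin.last n) : ℝ) (k₀ : ℝ) ≤ (n : ℝ) + 1 →
    ¬ ExhibitsNestedRuns f γ L₀ k

/-- The straight runs of `f` are `(γ, k₀)`-sparse, that is, sparse down to every positive scale. -/
def StraightRunsSparse {d : ℕ} (f : C(unitInterval, EuclideanSpace ℝ (Fin d)))
    (γ L₀ : ℝ) (k₀ : ℕ) : Prop :=
  ∀ ℓ : ℝ, 0 < ℓ → StraightRunsSparseDownTo f γ L₀ k₀ ℓ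

/-! The proof is a mass distribution argument on a tree of tight arcs, that is, arcs whose diameter
is the distance of their end points. An arc of diameter `γ * ℓ` crosses concentric shells around its
initial point, which yields `m` subarcs of diameter `ℓ` at mutual distance at least a fixed multiple
of `ℓ`. If the arc leaves its cylinder, the detour lengthens a path of straight chords by about `20
* ℓ`, enough for one more subarc (`IsTightArc.exists_subarcs_of_notMem_cylinder`).

Give the root mass one and let every arc share its mass equally among its children. Arcs with only
`m` children are straight runs, and those along a branch are nested. By sparsity they occupy at most
about half of the levels, so an arc at level `k` has mass at most a constant times `(m * (m + 1)) ^
(-k / 2)`, which is of order `L_k ^ s` (`StraightRunsSparse.prod_le`). A set smaller than the gap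
between siblings meets at most one of them, hence any cover must carry the whole mass
(`weight_le_sum`), and its `s`-sum is bounded below. -/

/-- A continuous real function which starts below `x` and ends above `y` has a crossing of `[x, y]`
that stays inside `[x, y]`. -/
theorem exists_crossing {φ : ℝ → ℝ} (hφ : Continuous φ) {a b x y : ℝ} (hab : a ≤ b) (hxy : x ≤ y)
    (hx : φ a ≤ x) (hy : y ≤ φ b) :
    ∃ s t, a ≤ s ∧ s ≤ t ∧ t ≤ b ∧ φ s = x ∧ φ t = y ∧ ∀ u ∈ Set.Icc s t, φ u ∈ Set.Icc x y := by
  have ivt : ∀ {p q z : ℝ}, p ≤ q → φ p ≤ z → z ≤ φ q → ∃ v ∈ Set.Icc p q, φ v = z :=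
    fun hpq h1 h2 => intermediate_value_Icc hpq hφ.continuousOn ⟨h1, h2⟩
  obtain ⟨t, ⟨⟨hat, htb⟩, hty⟩, htmin⟩ :=
    (isCompact_Icc.inter_right (isClosed_singleton.preimage hφ) :
      IsCompact (Set.Icc a b ∩ φ ⁻¹' {y})).exists_isLeast
      (by obtain ⟨v, hv, hv'⟩ := ivt hab (hx.trans hxy) hy; exact ⟨v, hv, hv'⟩)
  have hty : φ t = y := hty
  obtain ⟨s, ⟨⟨has, hst⟩, hsx⟩, hsmax⟩ :=
    (isCompact_Icc.inter_right (isClosed_singleton.preimage hφ) :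
      IsCompact (Set.Icc a t ∩ φ ⁻¹' {x})).exists_isGreatest
      (by obtain ⟨v, hv, hv'⟩ := ivt hat hx (hty ▸ hxy); exact ⟨v, hv, hv'⟩)
  have hsx : φ s = x := hsx
  refine ⟨s, t, has, hst, htb, hsx, hty, fun u hu => ⟨?_, ?_⟩⟩
  · by_contra! h
    obtain ⟨v, hv, hvx⟩ := ivt hu.2 h.le (hty ▸ hxy)
    have := hsmax ⟨⟨(has.trans hu.1).trans hv.1, hv.2⟩, hvx⟩
    have : v = u := le_antisymm (this.trans hu.1) hv.1
    subst this; exact h.ne hvx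
  · by_contra! h
    obtain ⟨v, hv, hvy⟩ := ivt (has.trans hu.1) (hx.trans hxy) h.le
    have := htmin ⟨⟨hv.1, (hv.2.trans hu.2).trans htb⟩, hvy⟩
    have : v = u := le_antisymm hv.2 (hu.2.trans this)
    subst this; exact h.ne' hvy

/-! ### Tight arcs in a metric space, and shells that separate them. -/

/-- The arc of `g` over the interval `[I.1, I.2]` has diameter `ℓ`, attained at its end points. -/
structure IsTightArc {E : Type*} [PseudoMetricSpace E] (g : ℝ → E) (ℓ : ℝ) (I : ℝ × ℝ) : Prop where
  le : I.1 ≤ I.2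
  dist_eq : dist (g I.1) (g I.2) = ℓ
  dist_le : ∀ u ∈ Set.Icc I.1 I.2, ∀ v ∈ Set.Icc I.1 I.2, dist (g u) (g v) ≤ ℓ

section Arcs

variable {E : Type*} [PseudoMetricSpace E] {g : ℝ → E}

/-- By compactness, some pair of parameters at distance at least `ℓ` in the image has the shortest
parameter interval. No strictly smaller interval has end points that far apart, and the intermediate
value theorem gives equality. -/
theorem exists_isTightArc (hg : Continuous g) {a b ℓ : ℝ} (hab : a ≤ b) (hℓ : 0 ≤ ℓ)
    (h : ℓ ≤ dist (g a) (g b)) : ∃ I, IsTightArc g ℓ I ∧ a ≤ I.1 ∧ I.2 ≤ b := by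
  have hK : IsCompact ((Set.Icc a b ×ˢ Set.Icc a b) ∩
      {q : ℝ × ℝ | q.1 ≤ q.2 ∧ ℓ ≤ dist (g q.1) (g q.2)}) := by
    refine (isCompact_Icc.prod isCompact_Icc).inter_right (IsClosed.inter ?_ ?_)
    · exact isClosed_le continuous_fst continuous_snd
    · exact isClosed_le continuous_const
        ((hg.comp continuous_fst).dist (hg.comp continuous_snd))
  obtain ⟨⟨s, t⟩, ⟨⟨hs, ht⟩, hst, hd⟩, hmin⟩ := hK.exists_isMinOn
    ⟨(a, b), ⟨⟨le_rfl, hab⟩, ⟨hab, le_rfl⟩⟩, hab, h⟩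
    (show ContinuousOn (fun q : ℝ × ℝ => q.2 - q.1) _ by fun_prop)
  simp only at hs ht hst hd
  have key : ∀ u v, s ≤ u → u ≤ v → v ≤ t → ℓ ≤ dist (g u) (g v) → u = s ∧ v = t := by
    intro u v hu huv hv hd'
    have h1 : t - s ≤ v - u :=
      hmin (a := (u, v)) ⟨⟨⟨hs.1.trans hu, by linarith [ht.2]⟩, ⟨by linarith [hs.1], hv.trans ht.2⟩⟩,
        huv, hd'⟩
    constructor <;> linarith
  have hdeq : dist (g s) (g t) = ℓ := by
    obtain ⟨v, hv, hvℓ⟩ := intermediate_value_Icc hst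
      (f := fun v => dist (g s) (g v)) (by fun_prop) (show ℓ ∈ Set.Icc _ _ from ⟨by simpa, hd⟩)
    have := key s v le_rfl hv.1 hv.2 hvℓ.ge
    rw [← this.2]; exact hvℓ
  have hle : ∀ u v, s ≤ u → u ≤ v → v ≤ t → dist (g u) (g v) ≤ ℓ := by
    intro u v hu huv hv
    by_contra! hlt
    obtain ⟨rfl, rfl⟩ := key u v hu huv hv hlt.le
    exact hlt.ne' hdeq
  refine ⟨(s, t), ⟨hst, hdeq, fun u hu v hv => ?_⟩, hs.1, ht.2⟩
  rcases le_total u v with huv | huv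
  · exact hle u v hu.1 huv hv.2
  · rw [dist_comm]; exact hle v u hv.1 huv hu.2

/-- A crossing of the shell changes the distance to `c` by `ℓ`, so its end points are at least `ℓ`
apart and it contains a tight arc. For `t ≤ s` the crossing runs inwards, whence the negated
distance. -/
theorem exists_isTightArc_in_shell (hg : Continuous g) {a b s t ℓ ρ : ℝ} {c : E}
    (hs : s ∈ Set.Icc a b) (ht : t ∈ Set.Icc a b) (hℓ : 0 ≤ ℓ) (hρ : 0 ≤ ρ) (hc : g s = c)
    (h : ρ + ℓ ≤ dist (g t) c) :
    ∃ I, IsTightArc g ℓ I ∧ a ≤ I.1 ∧ I.2 ≤ b ∧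
      ∀ u ∈ Set.Icc I.1 I.2, dist (g u) c ∈ Set.Icc ρ (ρ + ℓ) := by
  obtain ⟨p, q, hap, hpq, hqb, hd, hpos⟩ : ∃ p q, a ≤ p ∧ p ≤ q ∧ q ≤ b ∧
      ℓ ≤ dist (g p) (g q) ∧ ∀ u ∈ Set.Icc p q, dist (g u) c ∈ Set.Icc ρ (ρ + ℓ) := by
    have hcs : dist (g s) c = 0 := by simp [hc]
    rcases le_total s t with hst | hst
    · obtain ⟨p, q, h1, h2, h3, h4, h5, h6⟩ := exists_crossing (φ := fun u => dist (g u) c)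
        (by fun_prop) hst (show ρ ≤ ρ + ℓ by linarith) (by simpa [hcs] using hρ) h
      refine ⟨p, q, hs.1.trans h1, h2, h3.trans ht.2, ?_, h6⟩
      have := dist_triangle (g q) (g p) c
      rw [dist_comm (g q) (g p)] at this
      linarith
    · obtain ⟨p, q, h1, h2, h3, h4, h5, h6⟩ := exists_crossing (φ := fun u => -dist (g u) c)
        (by fun_prop) hst (show -(ρ + ℓ) ≤ -ρ by linarith) (by linarith) (by simpa [hcs] using hρ)
      refine ⟨p, q, ht.1.trans h1, h2, h3.trans hs.2, ?_, fun u hu => ?_⟩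
      · have := dist_triangle (g p) (g q) c
        linarith
      · have := h6 u hu
        exact ⟨by linarith [this.2], by linarith [this.1]⟩
  obtain ⟨I, hI, h1, h2⟩ := exists_isTightArc hg hpq hℓ hd
  exact ⟨I, hI, hap.trans h1, h2.trans hqb, fun u hu => hpos u ⟨h1.trans hu.1, hu.2.trans h2⟩⟩

/-- If a curve passes through the centres of finitely many disjoint balls and leaves each of
them, then concentric shells in these balls contain well separated tight arcs. -/
theorem exists_separated_arcs (hg : Continuous g) {J : Type*} [Fintype J] {a b ℓ η : ℝ}
    (hℓ : 0 < ℓ) (hη : 0 < η) (c : J → E) (α : J → ℝ)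
    (hdisj : ∀ i j, i ≠ j → α i + α j ≤ dist (c i) (c j))
    (hc : ∀ j, ∃ s ∈ Set.Icc a b, g s = c j)
    (hα : ∀ j, ∃ t ∈ Set.Icc a b, α j ≤ dist (g t) (c j))
    {N : ℕ} (hN : N ≤ ∑ j, ⌊α j / ((1 + η) * ℓ)⌋₊) :
    ∃ I : Fin N → ℝ × ℝ, (∀ i, IsTightArc g ℓ (I i) ∧ a ≤ (I i).1 ∧ (I i).2 ≤ b) ∧
      ∀ i j, i ≠ j → ∀ u ∈ Set.Icc (I i).1 (I i).2, ∀ v ∈ Set.Icc (I j).1 (I j).2,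
        η * ℓ ≤ dist (g u) (g v) := by
  have hw : 0 < (1 + η) * ℓ := by positivity
  have hηℓ : 0 < η * ℓ := by positivity
  -- The last summand is an empty collar: shells stay `η * ℓ` away from the boundary of their ball,
  -- which separates arcs in different balls.
  have hk : ∀ (j : J) (k : Fin ⌊α j / ((1 + η) * ℓ)⌋₊),
      k * ((1 + η) * ℓ) + ℓ + η * ℓ ≤ α j := by
    intro j k
    have hpos : ⌊α j / ((1 + η) * ℓ)⌋₊ ≠ 0 := fun h0 => by have := k.2; omega
    have h1 : ((k : ℕ) + 1 : ℝ) ≤ α j / ((1 + η) * ℓ) := by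
      have : (k : ℕ) + 1 ≤ ⌊α j / ((1 + η) * ℓ)⌋₊ := k.2
      have := (Nat.le_floor_iff' (by omega)).1 this
      exact_mod_cast this
    rw [le_div_iff₀ hw] at h1
    linarith
  have hex : ∀ x : (Σ j : J, Fin ⌊α j / ((1 + η) * ℓ)⌋₊), ∃ I : ℝ × ℝ,
      IsTightArc g ℓ I ∧ a ≤ I.1 ∧ I.2 ≤ b ∧ ∀ u ∈ Set.Icc I.1 I.2,
        dist (g u) (c x.1) ∈ Set.Icc ((x.2 : ℕ) * ((1 + η) * ℓ))
          ((x.2 : ℕ) * ((1 + η) * ℓ) + ℓ) := by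
    rintro ⟨j, k⟩
    obtain ⟨s, hs, hsc⟩ := hc j
    obtain ⟨t, ht, htα⟩ := hα j
    exact exists_isTightArc_in_shell hg hs ht hℓ.le (by positivity) hsc
      (by have := hk j k; simp only; linarith)
  choose I hI ha hb hshell using hex
  obtain ⟨e⟩ : Nonempty (Fin N ↪ (Σ j : J, Fin ⌊α j / ((1 + η) * ℓ)⌋₊)) :=
    Function.Embedding.nonempty_of_card_le (by simpa using hN)
  refine ⟨fun i => I (e i), fun i => ⟨hI _, ha _, hb _⟩, fun i j hij u hu v hv => ?_⟩
  have hne : e i ≠ e j := e.injective.ne hij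
  have h1 := hshell _ u hu
  have h2 := hshell _ v hv
  have h3 := hk _ (e i).2
  have h4 := hk _ (e j).2
  generalize e i = x at *
  generalize e j = y at *
  obtain ⟨j, k⟩ := x
  obtain ⟨j', k'⟩ := y
  simp only at h1 h2 h3 h4
  by_cases hjj : j = j'
  · subst hjj
    have hkk : (k : ℕ) ≠ k' := fun h => hne (by rw [Fin.ext h])
    have t1 := dist_triangle (g u) (g v) (c j)
    have t2 := dist_triangle (g v) (g u) (c j)
    rw [dist_comm (g v) (g u)] at t2
    rcases lt_or_gt_of_ne hkk with hlt | hlt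
    · have : ((k : ℕ) + 1 : ℝ) ≤ (k' : ℕ) := by exact_mod_cast hlt
      have := mul_le_mul_of_nonneg_right this hw.le
      linarith [h1.2, h2.1]
    · have : ((k' : ℕ) + 1 : ℝ) ≤ (k : ℕ) := by exact_mod_cast hlt
      have := mul_le_mul_of_nonneg_right this hw.le
      linarith [h2.2, h1.1]
  · have t0 := hdisj _ _ hjj
    have t1 := dist_triangle4 (c j) (g u) (g v) (c j')
    rw [dist_comm (c j) (g u)] at t1
    linarith [h1.2, h2.2]

end Arcs

/-! ### The detour outside a cylinder, and the subarcs it yields. -/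

/-- A point of the lens of two balls centred at the end points of `[x, y]` which is outside of a
cylinder around `[x, y]` causes a detour. -/
theorem add_le_dist_add_dist_of_notMem_cylinder {d : ℕ} {x y p : EuclideanSpace ℝ (Fin d)}
    {w : ℝ} (hw : 0 ≤ w) (hxy : 0 < dist x y) (hx : dist x p ≤ dist x y) (hy : dist p y ≤ dist x y)
    (hp : p ∉ cylinder x y w) :
    dist x y + w ^ 2 / (4 * dist x y) ≤ dist x p + dist p y := by
  set L := dist x y with hL
  set v := y - x with hv
  have hvL : ‖v‖ = L := by rw [hv, hL, dist_comm, dist_eq_norm]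
  set t := inner ℝ (p - x) v / L ^ 2 with ht
  have htL : inner ℝ (p - x) v = t * L ^ 2 := by rw [ht]; field_simp
  set c := x + t • v with hc
  have horth : inner ℝ (p - c) v = 0 := by
    rw [hc, ← sub_sub, inner_sub_left, inner_smul_left, real_inner_self_eq_norm_sq, hvL, htL]
    simp
  set h := ‖p - c‖ with hh
  have hxp : dist x p ^ 2 = (t * L) ^ 2 + h ^ 2 := by
    have : p - x = (p - c) + t • v := by rw [hc]; abel
    rw [dist_comm, dist_eq_norm, this, norm_add_sq_real, inner_smul_right, horth, norm_smul, hvL,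
      mul_pow, mul_pow, Real.norm_eq_abs, sq_abs]
    ring
  have hpy : dist p y ^ 2 = ((1 - t) * L) ^ 2 + h ^ 2 := by
    have : p - y = (p - c) + (t - 1) • v := by rw [hc, hv]; module
    rw [dist_eq_norm, this, norm_add_sq_real, inner_smul_right, horth, norm_smul, hvL,
      mul_pow, mul_pow, Real.norm_eq_abs, sq_abs]
    ring
  have h0 : 0 ≤ h := norm_nonneg _
  have hr1 : (0 : ℝ) ≤ dist x p := dist_nonneg
  have hr2 : (0 : ℝ) ≤ dist p y := dist_nonneg
  -- The lens condition puts the foot `c` of the perpendicular on the segment, so `p` can only miss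
  -- the cylinder by being far from the axis.
  have ht1 : t ≤ 1 := by
    have : (t * L) ^ 2 ≤ L ^ 2 := by nlinarith
    have := abs_le_of_sq_le_sq' this hxy.le
    nlinarith
  have ht0 : 0 ≤ t := by
    have : ((1 - t) * L) ^ 2 ≤ L ^ 2 := by nlinarith
    have := abs_le_of_sq_le_sq' this hxy.le
    nlinarith
  have hwh : w / 2 < h := by
    by_contra! hle
    refine hp ⟨c, ?_, horth, by rwa [dist_eq_norm]⟩
    rw [segment_eq_image']
    exact ⟨t, ⟨ht0, ht1⟩, rfl⟩
  have hsq : w ^ 2 / 4 ≤ h ^ 2 := by nlinarith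
  -- By Pythagoras `r - z = h ^ 2 / (r + z)`, and `r + z ≤ 2 * L`.
  have key : ∀ r z : ℝ, 0 ≤ r → r ≤ L → 0 ≤ z → r ^ 2 = z ^ 2 + h ^ 2 →
      z + h ^ 2 / (2 * L) ≤ r := by
    intro r z hr hrL hz he
    have hzr : z ≤ r := by nlinarith
    rw [← le_sub_iff_add_le', div_le_iff₀ (by positivity)]
    nlinarith
  have k1 := key _ _ hr1 hx (mul_nonneg ht0 hxy.le) hxp
  have k2 := key _ _ hr2 hy (mul_nonneg (sub_nonneg.2 ht1) hxy.le) hpy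
  have : w ^ 2 / (4 * L) ≤ h ^ 2 / (2 * L) + h ^ 2 / (2 * L) := by
    rw [← add_div, div_le_div_iff₀ (by positivity) (by positivity)]
    nlinarith
  linarith

/-- The separation of subarcs, relative to their scale. -/
noncomputable def arcGap (γ : ℝ) (m : ℕ) : ℝ := min ((γ - m) / m) 1

theorem arcGap_pos {γ : ℝ} {m : ℕ} (hm : 0 < m) (hγ : m < γ) : 0 < arcGap γ m := by
  have : (0 : ℝ) < m := by exact_mod_cast hm
  exact lt_min (div_pos (by linarith) this) one_pos

theorem mul_one_add_arcGap_le {γ : ℝ} {m : ℕ} (hm : 0 < m) :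
    m * (1 + arcGap γ m) ≤ γ := by
  have hm' : (0 : ℝ) < m := by exact_mod_cast hm
  have : arcGap γ m ≤ (γ - m) / m := min_le_left _ _
  rw [le_div_iff₀ hm'] at this
  linarith

theorem IsTightArc.exists_subarcs {E : Type*} [PseudoMetricSpace E] {g : ℝ → E}
    (hg : Continuous g) {γ ℓ : ℝ} {m : ℕ} (hm : 0 < m) (hγ : m < γ) (hℓ : 0 < ℓ) {I : ℝ × ℝ}
    (hI : IsTightArc g (γ * ℓ) I) :
    ∃ c : Fin m → ℝ × ℝ, (∀ i, IsTightArc g ℓ (c i) ∧ I.1 ≤ (c i).1 ∧ (c i).2 ≤ I.2) ∧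
      ∀ i j, i ≠ j → ∀ u ∈ Set.Icc (c i).1 (c i).2, ∀ v ∈ Set.Icc (c j).1 (c j).2,
        arcGap γ m * ℓ ≤ dist (g u) (g v) := by
  have hη := arcGap_pos hm hγ
  refine exists_separated_arcs hg hℓ hη (J := Unit) (fun _ => g I.1) (fun _ => γ * ℓ)
    (fun i j h => (h rfl).elim) (fun _ => ⟨_, Set.left_mem_Icc.2 hI.le, rfl⟩)
    (fun _ => ⟨_, Set.right_mem_Icc.2 hI.le, by rw [dist_comm, hI.dist_eq]⟩) ?_
  simp only [Finset.univ_unique, Finset.sum_const, Finset.card_singleton, one_smul]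
  refine Nat.le_floor ?_
  rw [le_div_iff₀ (by positivity)]
  nlinarith [mul_one_add_arcGap_le (γ := γ) hm]

theorem IsTightArc.exists_subarcs_of_notMem_cylinder {d : ℕ} {g : ℝ → EuclideanSpace ℝ (Fin d)}
    (hg : Continuous g) {γ ℓ : ℝ} {m : ℕ} (hm : 0 < m) (hγ : m < γ) (hℓ : 0 < ℓ) {I : ℝ × ℝ}
    (hI : IsTightArc g (γ * ℓ) I) {u : ℝ} (hu : u ∈ Set.Icc I.1 I.2)
    (hcyl : g u ∉ cylinder (g I.1) (g I.2) (9 / √γ * (γ * ℓ))) :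
    ∃ c : Fin (m + 1) → ℝ × ℝ, (∀ i, IsTightArc g ℓ (c i) ∧ I.1 ≤ (c i).1 ∧ (c i).2 ≤ I.2) ∧
      ∀ i j, i ≠ j → ∀ u ∈ Set.Icc (c i).1 (c i).2, ∀ v ∈ Set.Icc (c j).1 (c j).2,
        arcGap γ m * ℓ ≤ dist (g u) (g v) := by
  have hη := arcGap_pos hm hγ
  have hγ0 : 0 < γ := lt_of_le_of_lt (Nat.cast_nonneg m) hγ
  have hl : I.1 ∈ Set.Icc I.1 I.2 := Set.left_mem_Icc.2 hI.le
  have hr : I.2 ∈ Set.Icc I.1 I.2 := Set.right_mem_Icc.2 hI.le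
  have hdet := add_le_dist_add_dist_of_notMem_cylinder (by positivity)
    (by rw [hI.dist_eq]; positivity) (by rw [hI.dist_eq]; exact hI.dist_le _ hl _ hu)
    (by rw [hI.dist_eq]; exact hI.dist_le _ hu _ hr) hcyl
  rw [hI.dist_eq] at hdet
  have hw : (9 / √γ * (γ * ℓ)) ^ 2 / (4 * (γ * ℓ)) = 81 / 4 * ℓ := by
    rw [mul_pow, div_pow, Real.sq_sqrt hγ0.le]
    field_simp
    norm_num
  rw [hw] at hdet
  set r₁ := dist (g I.1) (g u) with hr₁
  set r₂ := dist (g u) (g I.2) with hr₂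
  set L := γ * ℓ with hL
  set η := arcGap γ m
  have hη1 : η ≤ 1 := min_le_right _ _
  have t1 : r₁ ≤ L + r₂ := by
    have := dist_triangle (g I.1) (g I.2) (g u)
    rw [hI.dist_eq, dist_comm (g I.2)] at this; exact this
  have t2 : r₂ ≤ r₁ + L := by
    have := dist_triangle (g u) (g I.1) (g I.2)
    rw [hI.dist_eq, dist_comm (g u) (g I.1)] at this; exact this
  have t3 : L ≤ r₁ + r₂ := by
    have := dist_triangle (g I.1) (g u) (g I.2)
    rw [hI.dist_eq] at this; exact this
  have e1 : dist (g I.2) (g I.1) = L := by rw [dist_comm, hI.dist_eq]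
  have e2 : dist (g u) (g I.1) = r₁ := dist_comm _ _
  have e3 : dist (g I.2) (g u) = r₂ := dist_comm _ _
  have e4 : dist (g I.1) (g I.2) = L := hI.dist_eq
  -- The radii are the Gromov products of the triangle: the three balls are pairwise tangent, and
  -- the radii add up to half the perimeter, at least `L + 81 / 8 * ℓ`.
  refine exists_separated_arcs hg hℓ hη ![g I.1, g u, g I.2]
    ![(L + r₁ - r₂) / 2, (r₁ + r₂ - L) / 2, (L + r₂ - r₁) / 2] ?_ ?_ ?_ ?_
  · intro i j hij
    fin_cases i <;> fin_cases j <;> simp [e1, e2, e3, e4, ← hr₁, ← hr₂] at hij ⊢ <;> linarith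
  · intro j
    fin_cases j
    exacts [⟨_, hl, rfl⟩, ⟨_, hu, rfl⟩, ⟨_, hr, rfl⟩]
  · intro j
    fin_cases j
    · exact ⟨_, hr, by simp only [Fin.zero_eta, Matrix.cons_val_zero, e1]; linarith⟩
    · exact ⟨_, hr, by simp [e3]; linarith⟩
    · exact ⟨_, hl, by simp [e4]; linarith⟩
  · have hw : 0 < (1 + η) * ℓ := by positivity
    simp only [Fin.sum_univ_three, Matrix.cons_val_zero, Matrix.cons_val_one, Matrix.cons_val]
    have f1 := Nat.lt_floor_add_one ((L + r₁ - r₂) / 2 / ((1 + η) * ℓ))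
    have f2 := Nat.lt_floor_add_one ((r₁ + r₂ - L) / 2 / ((1 + η) * ℓ))
    have f3 := Nat.lt_floor_add_one ((L + r₂ - r₁) / 2 / ((1 + η) * ℓ))
    -- Rounding down three times loses less than 3, so `m + 4` leaves `m + 1`. Since `η ≤ 1`, the
    -- extra 4 shells cost at most `8 * ℓ`, which the detour pays for; this is what the constant 9
    -- in the cylinder width provides.
    have hsum : (m + 4 : ℝ) ≤ (L + r₁ - r₂) / 2 / ((1 + η) * ℓ) +
        (r₁ + r₂ - L) / 2 / ((1 + η) * ℓ) + (L + r₂ - r₁) / 2 / ((1 + η) * ℓ) := by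
      rw [← add_div, ← add_div, le_div_iff₀ hw]
      have h1 : (m + 4 : ℝ) * (1 + η) ≤ γ + 8 := by
        have := mul_one_add_arcGap_le (γ := γ) hm
        change m * (1 + η) ≤ γ at this
        linarith
      have h2 := mul_le_mul_of_nonneg_right h1 hℓ.le
      have h3 : (γ + 8) * ℓ = L + 8 * ℓ := by rw [hL]; ring
      linarith
    have : (m : ℝ) + 1 < (⌊(L + r₁ - r₂) / 2 / ((1 + η) * ℓ)⌋₊ +
        ⌊(r₁ + r₂ - L) / 2 / ((1 + η) * ℓ)⌋₊ + ⌊(L + r₂ - r₁) / 2 / ((1 + η) * ℓ)⌋₊ : ℝ) := by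
      linarith
    exact_mod_cast this.le

/-! ### Finite covers from small dimension, and mass on a tree of arcs. -/

open scoped MeasureTheory ENNReal NNReal in
theorem exists_finite_cover_of_dimH_lt {X : Type*} [MetricSpace X] {K : Set X} (hK : IsCompact K)
    {s : ℝ} (hs : 0 < s) (h : dimH K < ENNReal.ofReal s) {κ : ℝ} (hκ : 0 < κ) :
    ∃ (T : Finset ℕ) (U : ℕ → Set X) (ρ : ℕ → ℝ), K ⊆ ⋃ n ∈ T, U n ∧ (∀ n, 0 < ρ n) ∧
      (∀ n, ∀ x ∈ U n, ∀ y ∈ U n, dist x y ≤ ρ n) ∧ ∑ n ∈ T, ρ n ^ s < κ := by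
  borelize X
  have h0 : μH[s] K = 0 := by
    have := hausdorffMeasure_of_dimH_lt (d := s.toNNReal) h
    rwa [Real.coe_toNNReal _ hs.le] at this
  have hκ2 : (0 : ℝ≥0∞) < ENNReal.ofReal (κ / 2) := ENNReal.ofReal_pos.2 (by positivity)
  rw [MeasureTheory.Measure.hausdorffMeasure_apply] at h0
  -- The mesh bound 1 is arbitrary; it only makes the diameters finite.
  have h1 := iSup₂_le_iff.1 h0.le 1 one_pos
  have h2 := lt_of_le_of_lt h1 hκ2
  simp only [iInf_lt_iff] at h2
  obtain ⟨t, htK, htd, hsum⟩ := h2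
  obtain ⟨e, he, hesum⟩ := ENNReal.exists_pos_sum_of_countable hκ2.ne' ℕ
  have hfin : ∀ n, Metric.ediam (t n) ≠ ⊤ := fun n => ne_top_of_le_ne_top ENNReal.one_ne_top (htd n)
  set D : ℕ → ℝ := fun n => Metric.diam (t n) with hD
  have hD0 : ∀ n, 0 ≤ D n := fun n => Metric.diam_nonneg
  have hpos : ∀ n, 0 < D n ^ s + e n := fun n =>
    add_pos_of_nonneg_of_pos (Real.rpow_nonneg (hD0 n) _) (NNReal.coe_pos.2 (he n))
  -- The summable slack `e n` makes `ρ n` exceed the diameter, also when that is zero. This leaves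
  -- room for open thickenings, from which compactness extracts a finite subcover.
  set ρ : ℕ → ℝ := fun n => (D n ^ s + e n) ^ s⁻¹ with hρ
  have hρs : ∀ n, ρ n ^ s = D n ^ s + e n := fun n => Real.rpow_inv_rpow (hpos n).le hs.ne'
  have hDρ : ∀ n, D n < ρ n := by
    intro n
    have : D n ^ s < ρ n ^ s := by
      rw [hρs]; exact lt_add_of_pos_right _ (NNReal.coe_pos.2 (he n))
    exact (Real.rpow_lt_rpow_iff (hD0 n) (Real.rpow_nonneg (hpos n).le _) hs).1 this
  obtain ⟨T, hT⟩ := hK.elim_finite_subcover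
    (fun n => Metric.thickening ((ρ n - D n) / 2) (t n)) (fun n => Metric.isOpen_thickening)
    (htK.trans (Set.iUnion_mono fun n => Metric.self_subset_thickening
      (by linarith [hDρ n]) _))
  refine ⟨T, _, ρ, hT, fun n => (hD0 n).trans_lt (hDρ n), fun n x hx y hy => ?_, ?_⟩
  · have hb : Bornology.IsBounded (t n) := Metric.isBounded_iff_ediam_ne_top.2 (hfin n)
    have h3 := Metric.dist_le_diam_of_mem hb.thickening hx hy
    have h4 := Metric.diam_thickening_le (t n) (show 0 ≤ (ρ n - D n) / 2 by linarith [hDρ n])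
    change _ ≤ D n + _ at h4
    linarith
  · have hlt : ∑ n ∈ T, ENNReal.ofReal (ρ n ^ s) < ENNReal.ofReal κ := by
      calc ∑ n ∈ T, ENNReal.ofReal (ρ n ^ s)
          = ∑ n ∈ T, ((⨆ _ : (t n).Nonempty, Metric.ediam (t n) ^ s) + (e n : ℝ≥0∞)) := by
            refine Finset.sum_congr rfl fun n _ => ?_
            rw [hρs, ENNReal.ofReal_add (Real.rpow_nonneg (hD0 n) _) (e n).coe_nonneg,
              ENNReal.ofReal_coe_nnreal, ← ENNReal.ofReal_rpow_of_nonneg (hD0 n) hs.le]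
            congr 1
            have hd : ENNReal.ofReal (D n) = Metric.ediam (t n) := ENNReal.ofReal_toReal (hfin n)
            rw [hd]
            by_cases hne : (t n).Nonempty
            · simp [hne]
            · rw [Set.not_nonempty_iff_eq_empty] at hne
              simp [hne, hs]
        _ ≤ (∑' n, ⨆ _ : (t n).Nonempty, Metric.ediam (t n) ^ s) + ∑' n, (e n : ℝ≥0∞) := by
            rw [Finset.sum_add_distrib]
            exact add_le_add (ENNReal.sum_le_tsum _) (ENNReal.sum_le_tsum _)
        _ < ENNReal.ofReal (κ / 2) + ENNReal.ofReal (κ / 2) := ENNReal.add_lt_add hsum hesum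
        _ = ENNReal.ofReal κ := by
            rw [← ENNReal.ofReal_add (by positivity) (by positivity), add_halves]
    have hnn : ∀ n ∈ T, 0 ≤ ρ n ^ s := fun n _ => by rw [hρs]; exact (hpos n).le
    rw [← ENNReal.ofReal_sum_of_nonneg hnn] at hlt
    exact (ENNReal.ofReal_lt_ofReal_iff hκ).1 hlt

/-- A sequence of arcs, nested from index `k₁` to index `k`, the `i`-th of which is good for `i`. -/
structure IsLineage (Good : ℕ → ℝ × ℝ → Prop) (k₁ k : ℕ) (A : ℕ → ℝ × ℝ) : Prop where
  good : ∀ i, k₁ ≤ i → i ≤ k → Good i (A i)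
  nested : ∀ i j, k₁ ≤ i → i ≤ j → j ≤ k → (A i).1 ≤ (A j).1 ∧ (A j).2 ≤ (A i).2

theorem IsLineage.update {Good : ℕ → ℝ × ℝ → Prop} {k₁ k : ℕ} {A : ℕ → ℝ × ℝ}
    (hA : IsLineage Good k₁ k A) {J : ℝ × ℝ} (hJ : Good (k + 1) J)
    (hAJ : (A k).1 ≤ J.1 ∧ J.2 ≤ (A k).2) :
    IsLineage Good k₁ (k + 1) (Function.update A (k + 1) J) := by
  constructor
  · intro i h1 h2
    rcases h2.eq_or_lt with rfl | h2
    · simpa using hJ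
    · rw [Function.update_of_ne h2.ne]
      exact hA.good i h1 (by omega)
  · intro i j h1 h2 h3
    rcases h3.eq_or_lt with rfl | h3
    · rw [Function.update_self]
      rcases h2.eq_or_lt with rfl | h2
      · simp
      · rw [Function.update_of_ne h2.ne]
        have := hA.nested i k h1 (by omega) le_rfl
        exact ⟨this.1.trans hAJ.1, hAJ.2.trans this.2⟩
    · rw [Function.update_of_ne h3.ne, Function.update_of_ne (by omega)]
      exact hA.nested i j h1 h2 (by omega)

open scoped Classical in
/-- In a tree of arcs with separated children, the mass of an arc is at most the total mass bound
of the covering sets that it meets. -/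
theorem weight_le_sum {E : Type*} [PseudoMetricSpace E] {g : ℝ → E}
    {Good : ℕ → ℝ × ℝ → Prop} {N : ℕ → ℝ × ℝ → ℕ} {δ B : ℕ → ℝ} {k₁ : ℕ}
    (hle : ∀ k I, Good k I → I.1 ≤ I.2)
    (hN : ∀ k I, 0 < N k I) (hδ : Antitone δ) (hB : Antitone B) (hB0 : ∀ k, 0 ≤ B k)
    (hbranch : ∀ k I, Good k I → ∃ c : Fin (N k I) → ℝ × ℝ,
      (∀ i, Good (k + 1) (c i) ∧ I.1 ≤ (c i).1 ∧ (c i).2 ≤ I.2) ∧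
      ∀ i j, i ≠ j → ∀ u ∈ Set.Icc (c i).1 (c i).2, ∀ v ∈ Set.Icc (c j).1 (c j).2,
        δ (k + 1) ≤ dist (g u) (g v))
    (hprod : ∀ k A, k₁ ≤ k → IsLineage Good k₁ k A →
      ∏ i ∈ Finset.Ico k₁ k, (N i (A i) : ℝ)⁻¹ ≤ B k)
    {T : Finset ℕ} {U : ℕ → Set E} {q : ℕ → ℕ}
    (hU : ∀ n ∈ T, ∀ x ∈ U n, ∀ y ∈ U n, dist x y < δ (q n))
    (hcov : ∀ k I, Good k I → g I.1 ∈ ⋃ n ∈ T, U n)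
    {K : ℕ} (hK : ∀ n ∈ T, q n ≤ K) (r : ℕ) :
    ∀ k A, k₁ ≤ k → K ≤ k + r → IsLineage Good k₁ k A →
      ∏ i ∈ Finset.Ico k₁ k, (N i (A i) : ℝ)⁻¹ ≤
        ∑ n ∈ T with ∃ u ∈ Set.Icc (A k).1 (A k).2, g u ∈ U n, B (q n) := by
  have of_le : ∀ k A, k₁ ≤ k → IsLineage Good k₁ k A →
      (∃ n ∈ T, (∃ u ∈ Set.Icc (A k).1 (A k).2, g u ∈ U n) ∧ q n ≤ k) →
      ∏ i ∈ Finset.Ico k₁ k, (N i (A i) : ℝ)⁻¹ ≤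
        ∑ n ∈ T with ∃ u ∈ Set.Icc (A k).1 (A k).2, g u ∈ U n, B (q n) := by
    rintro k A hk hA ⟨n, hn, hmeet, hq⟩
    exact ((hprod k A hk hA).trans (hB hq)).trans
      (Finset.single_le_sum (f := fun n => B (q n)) (fun i _ => hB0 _)
        (Finset.mem_filter.2 ⟨hn, hmeet⟩))
  -- Induction on the number of generations left before level `K`, beyond which every covering set
  -- counts as large.
  induction r with
  | zero =>
    intro k A hk hKk hA
    have hG := hA.good k hk le_rfl
    obtain ⟨n, hn, hgn⟩ := Set.mem_iUnion₂.1 (hcov k _ hG)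
    exact of_le k A hk hA ⟨n, hn, ⟨_, Set.left_mem_Icc.2 (hle _ _ hG), hgn⟩, (hK n hn).trans hKk⟩
  | succ r ih =>
    intro k A hk hKk hA
    by_cases hex : ∃ n ∈ T, (∃ u ∈ Set.Icc (A k).1 (A k).2, g u ∈ U n) ∧ q n ≤ k
    · exact of_le k A hk hA hex
    push Not at hex
    obtain ⟨c, hc, hsep⟩ := hbranch k (A k) (hA.good k hk le_rfl)
    have hprod_eq : ∏ i ∈ Finset.Ico k₁ k, (N i (A i) : ℝ)⁻¹ =
        ∑ j : Fin (N k (A k)), ∏ i ∈ Finset.Ico k₁ (k + 1),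
          (N i (Function.update A (k + 1) (c j) i) : ℝ)⁻¹ := by
      have hN0 : (N k (A k) : ℝ) ≠ 0 := by exact_mod_cast (hN k (A k)).ne'
      have : ∀ j, ∏ i ∈ Finset.Ico k₁ (k + 1), (N i (Function.update A (k + 1) (c j) i) : ℝ)⁻¹ =
          (∏ i ∈ Finset.Ico k₁ k, (N i (A i) : ℝ)⁻¹) * (N k (A k) : ℝ)⁻¹ := by
        intro j
        rw [← Finset.prod_Ico_succ_top hk (fun i => (N i (A i) : ℝ)⁻¹)]
        refine Finset.prod_congr rfl fun i hi => ?_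
        rw [Function.update_of_ne (Finset.mem_Ico.1 hi).2.ne]
      simp only [this, Finset.sum_const, Finset.card_univ, Fintype.card_fin, nsmul_eq_mul]
      field_simp
    rw [hprod_eq]
    refine (Finset.sum_le_sum fun j _ => ih (k + 1) _ (by omega) (by omega)
      (hA.update (hc j).1 (hc j).2)).trans ?_
    simp only [Function.update_self]
    rw [← Finset.sum_biUnion]
    · refine Finset.sum_le_sum_of_subset_of_nonneg ?_ fun _ _ _ => hB0 _
      intro n hn
      simp only [Finset.mem_biUnion, Finset.mem_univ, true_and, Finset.mem_filter] at hn ⊢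
      obtain ⟨j, hnT, u, hu, hgu⟩ := hn
      exact ⟨hnT, u, ⟨(hc j).2.1.trans hu.1, hu.2.trans (hc j).2.2⟩, hgu⟩
    -- All sets met have `q n > k`, so their points are closer together than the gap between
    -- siblings: no set meets two children.
    · intro j _ j' _ hjj
      rw [Function.onFun, Finset.disjoint_left]
      intro n hn hn'
      simp only [Finset.mem_filter] at hn hn'
      obtain ⟨hnT, u, hu, hgu⟩ := hn
      obtain ⟨-, v, hv, hgv⟩ := hn'
      have h1 := hsep j j' hjj u hu v hv
      have h2 := hU n hnT _ hgu _ hgv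
      have h3 : k < q n := hex n hnT ⟨u, ⟨(hc j).2.1.trans hu.1, hu.2.trans (hc j).2.2⟩, hgu⟩
      have h4 : δ (q n) ≤ δ (k + 1) := hδ h3
      linarith

/-! ### Sparse straight runs and the dimension bound. -/

section SparseRuns

variable {d : ℕ}

theorem lengthScale_pos {γ L₀ : ℝ} (hγ : 0 < γ) (hL : 0 < L₀) (k : ℕ) : 0 < lengthScale γ L₀ k :=
  div_pos hL (pow_pos hγ k)

theorem lengthScale_eq_mul_succ {γ : ℝ} (hγ : 0 < γ) (L₀ : ℝ) (k : ℕ) :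
    lengthScale γ L₀ k = γ * lengthScale γ L₀ (k + 1) := by
  unfold lengthScale
  rw [pow_succ]
  field_simp

theorem lengthScale_antitone {γ L₀ : ℝ} (hγ : 1 < γ) (hL : 0 < L₀) :
    Antitone (lengthScale γ L₀) := by
  refine antitone_nat_of_succ_le fun k => ?_
  rw [lengthScale_eq_mul_succ (by linarith) L₀ k]
  nlinarith [lengthScale_pos (by linarith : 0 < γ) hL (k + 1)]

/-- The curve, extended to the real line by constants. -/
noncomputable def extendedCurve (f : C(unitInterval, EuclideanSpace ℝ (Fin d))) (t : ℝ) :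
    EuclideanSpace ℝ (Fin d) :=
  f (Set.projIcc 0 1 zero_le_one t)

theorem continuous_extendedCurve (f : C(unitInterval, EuclideanSpace ℝ (Fin d))) :
    Continuous (extendedCurve f) :=
  f.continuous.comp continuous_projIcc

@[simp]
theorem extendedCurve_coe (f : C(unitInterval, EuclideanSpace ℝ (Fin d))) (t : unitInterval) :
    extendedCurve f t = f t := by
  rw [extendedCurve, Set.projIcc_val]

/-- Parameter intervals of tight arcs of the curve at scale `L_k`. -/
def IsTightSubarc (f : C(unitInterval, EuclideanSpace ℝ (Fin d))) (γ L₀ : ℝ) (k : ℕ)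
    (I : ℝ × ℝ) : Prop :=
  0 ≤ I.1 ∧ I.2 ≤ 1 ∧ IsTightArc (extendedCurve f) (lengthScale γ L₀ k) I

/-- The arc over `[I.1, I.2]` stays in its cylinder at scale `L_k`. -/
def StaysInCylinder (f : C(unitInterval, EuclideanSpace ℝ (Fin d))) (γ L₀ : ℝ) (k : ℕ)
    (I : ℝ × ℝ) : Prop :=
  ∀ u ∈ Set.Icc I.1 I.2, extendedCurve f u ∈
    cylinder (extendedCurve f I.1) (extendedCurve f I.2) (9 / √γ * lengthScale γ L₀ k)

open scoped Classical in
/-- The number of children of an arc: one more if the arc is not a straight run. -/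
noncomputable def numSubarcs (f : C(unitInterval, EuclideanSpace ℝ (Fin d))) (γ L₀ : ℝ) (m : ℕ)
    (k : ℕ) (I : ℝ × ℝ) : ℕ :=
  if StaysInCylinder f γ L₀ k I then m else m + 1

theorem IsTightSubarc.exists_subarcs {f : C(unitInterval, EuclideanSpace ℝ (Fin d))} {γ L₀ : ℝ}
    {m : ℕ} (hm : 0 < m) (hγ : m < γ) (hL : 0 < L₀) {k : ℕ} {I : ℝ × ℝ}
    (hI : IsTightSubarc f γ L₀ k I) :
    ∃ c : Fin (numSubarcs f γ L₀ m k I) → ℝ × ℝ,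
      (∀ i, IsTightSubarc f γ L₀ (k + 1) (c i) ∧ I.1 ≤ (c i).1 ∧ (c i).2 ≤ I.2) ∧
      ∀ i j, i ≠ j → ∀ u ∈ Set.Icc (c i).1 (c i).2, ∀ v ∈ Set.Icc (c j).1 (c j).2,
        arcGap γ m * lengthScale γ L₀ (k + 1) ≤ dist (extendedCurve f u) (extendedCurve f v) := by
  obtain ⟨h0, h1, hT⟩ := hI
  have hγ0 : 0 < γ := lt_of_le_of_lt (Nat.cast_nonneg m) hγ
  have hl := lengthScale_pos hγ0 hL (k + 1)
  have hg := continuous_extendedCurve f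
  have hcyl : ¬ StaysInCylinder f γ L₀ k I → ∃ u ∈ Set.Icc I.1 I.2, extendedCurve f u ∉
      cylinder (extendedCurve f I.1) (extendedCurve f I.2)
        (9 / √γ * (γ * lengthScale γ L₀ (k + 1))) := by
    intro h
    rw [← lengthScale_eq_mul_succ hγ0]
    simpa only [StaysInCylinder, not_forall, exists_prop] using h
  rw [lengthScale_eq_mul_succ hγ0] at hT
  by_cases hs : StaysInCylinder f γ L₀ k I
  · rw [numSubarcs, if_pos hs]
    obtain ⟨c, hc, hsep⟩ := hT.exists_subarcs hg hm hγ hl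
    exact ⟨c, fun i => ⟨⟨h0.trans (hc i).2.1, (hc i).2.2.trans h1, (hc i).1⟩, (hc i).2⟩, hsep⟩
  · rw [numSubarcs, if_neg hs]
    obtain ⟨u, hu, hnot⟩ := hcyl hs
    obtain ⟨c, hc, hsep⟩ := hT.exists_subarcs_of_notMem_cylinder hg hm hγ hl hu hnot
    exact ⟨c, fun i => ⟨⟨h0.trans (hc i).2.1, (hc i).2.2.trans h1, (hc i).1⟩, (hc i).2⟩, hsep⟩

open scoped Classical in
/-- Sparsity bounds the number of straight runs in a lineage. -/
theorem StraightRunsSparse.two_mul_card_le {f : C(unitInterval, EuclideanSpace ℝ (Fin d))}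
    {γ L₀ : ℝ} {k₀ : ℕ} (hγ : 0 < γ) (hL : 0 < L₀) (hf : StraightRunsSparse f γ L₀ k₀)
    {k₁ k : ℕ} {A : ℕ → ℝ × ℝ} (hA : IsLineage (IsTightSubarc f γ L₀) k₁ k A) :
    2 * ((Finset.Ico k₁ k).filter fun i => StaysInCylinder f γ L₀ i (A i)).card ≤ k + k₀ := by
  set S := (Finset.Ico k₁ k).filter fun i => StaysInCylinder f γ L₀ i (A i) with hS
  rcases hn : S.card with _ | n
  · omega
  set e := S.orderEmbOfFin hn with he
  have hmem : ∀ i, (k₁ ≤ e i ∧ e i < k) ∧ StaysInCylinder f γ L₀ (e i) (A (e i)) := by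
    intro i
    have := S.orderEmbOfFin_mem hn i
    simpa only [hS, Finset.mem_filter, Finset.mem_Ico] using this
  have hgood : ∀ i, IsTightSubarc f γ L₀ (e i) (A (e i)) := fun i =>
    hA.good _ (hmem i).1.1 (hmem i).1.2.le
  -- A tight arc that stays in its cylinder is a straight run, and later arcs of the lineage lie
  -- over subintervals of it.
  have hex : ExhibitsNestedRuns f γ L₀ e := by
    refine ⟨fun i => ⟨(A (e i)).1, (hgood i).1, (hgood i).2.2.le.trans (hgood i).2.1⟩,
      fun i => ⟨(A (e i)).2, (hgood i).1.trans (hgood i).2.2.le, (hgood i).2.1⟩, fun i => ?_,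
      fun i j hij => ?_⟩
    · refine ⟨(hgood i).2.2.le, ?_, ?_⟩
      · rw [← extendedCurve_coe, ← extendedCurve_coe]
        exact (hgood i).2.2.dist_eq
      · rintro _ ⟨x, hx, rfl⟩
        rw [runCylinder, ← extendedCurve_coe, ← extendedCurve_coe, ← extendedCurve_coe]
        exact (hmem i).2 x hx
    · rintro _ ⟨x, hx, rfl⟩
      rw [runCylinder, ← extendedCurve_coe, ← extendedCurve_coe, ← extendedCurve_coe]
      have hlt : e i < e j := e.strictMono hij
      have := hA.nested (e i) (e j) (hmem i).1.1 hlt.le (hmem j).1.2.le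
      exact (hmem i).2 x ⟨this.1.trans hx.1, le_trans hx.2 this.2⟩
  by_contra! hlt
  refine hf _ (lengthScale_pos hγ hL (e (Fin.last n))) n e e.strictMono le_rfl ?_ hex
  have h1 : max (e (Fin.last n) : ℝ) k₀ ≤ k + k₀ :=
    max_le (by have : (e (Fin.last n) : ℝ) ≤ k := by exact_mod_cast (hmem _).1.2.le
               have : (0 : ℝ) ≤ k₀ := Nat.cast_nonneg _
               linarith) (by simp)
  have h2 : (k + k₀ : ℝ) < 2 * (n + 1) := by exact_mod_cast hlt
  linarith

/-- With `R = √((m + 1) / m)`, a straight run contributes `R ^ 2 / (m + 1)` and any other arc `1 /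
(m + 1)`. Sparsity bounds the exponent of `R` by `k + k₀`, and `R / (m + 1)` is the inverse of `√(m
* (m + 1))`. -/
theorem StraightRunsSparse.prod_le {f : C(unitInterval, EuclideanSpace ℝ (Fin d))}
    {γ L₀ : ℝ} {k₀ m : ℕ} (hγ : 0 < γ) (hL : 0 < L₀) (hm : 0 < m)
    (hf : StraightRunsSparse f γ L₀ k₀) {k₁ k : ℕ} (hk : k₁ ≤ k) {A : ℕ → ℝ × ℝ}
    (hA : IsLineage (IsTightSubarc f γ L₀) k₁ k A) :
    ∏ i ∈ Finset.Ico k₁ k, (numSubarcs f γ L₀ m i (A i) : ℝ)⁻¹ ≤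
      (m + 1 : ℝ) ^ k₁ * √((m + 1) / m) ^ k₀ * (√((m : ℝ) * (m + 1)))⁻¹ ^ k := by
  classical
  have hm' : (0 : ℝ) < m := by exact_mod_cast hm
  have hR : (1 : ℝ) ≤ √((m + 1) / m) := by
    rw [Real.one_le_sqrt, le_div_iff₀ hm']; linarith
  have hRsq : √((m + 1 : ℝ) / m) ^ 2 = (m + 1) / m := Real.sq_sqrt (by positivity)
  have hN : ∀ i, (numSubarcs f γ L₀ m i (A i) : ℝ)⁻¹ = (m + 1 : ℝ)⁻¹ *
      if StaysInCylinder f γ L₀ i (A i) then √((m + 1 : ℝ) / m) ^ 2 else 1 := by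
    intro i
    rw [numSubarcs, hRsq]
    split_ifs
    · field_simp
    · push_cast; simp
  have hσ : (√((m : ℝ) * (m + 1)))⁻¹ = (m + 1 : ℝ)⁻¹ * √((m + 1) / m) := by
    rw [Real.sqrt_mul hm'.le, Real.sqrt_div (by positivity)]
    have h2 : √(m + 1 : ℝ) * √(m + 1 : ℝ) = m + 1 := Real.mul_self_sqrt (by positivity)
    have h3 : 0 < √(m : ℝ) := Real.sqrt_pos.2 hm'
    have h4 : 0 < √(m + 1 : ℝ) := Real.sqrt_pos.2 (by positivity)
    field_simp
    rw [sq, h2]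
  simp only [hN]
  rw [Finset.prod_mul_distrib, Finset.prod_const, Nat.card_Ico, Finset.prod_ite, Finset.prod_const,
    Finset.prod_const_one, mul_one, ← pow_mul, hσ, mul_pow]
  have hpow : (m + 1 : ℝ)⁻¹ ^ (k - k₁) = (m + 1 : ℝ) ^ k₁ * (m + 1 : ℝ)⁻¹ ^ k := by
    obtain ⟨r, rfl⟩ := Nat.exists_eq_add_of_le hk
    rw [Nat.add_sub_cancel_left, pow_add, ← mul_assoc, ← mul_pow,
      mul_inv_cancel₀ (by positivity), one_pow, one_mul]
  rw [hpow]
  calc _ ≤ (m + 1 : ℝ) ^ k₁ * (m + 1 : ℝ)⁻¹ ^ k * √((m + 1) / m) ^ (k + k₀) :=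
        mul_le_mul_of_nonneg_left (pow_le_pow_right₀ hR (hf.two_mul_card_le hγ hL hA))
          (by positivity)
    _ = _ := by rw [pow_add]; ring

/-- A nontrivial curve has tight arcs on all sufficiently small scales. -/
theorem exists_isTightSubarc {f : C(unitInterval, EuclideanSpace ℝ (Fin d))}
    (hf : (Set.range f).Nontrivial) {γ L₀ : ℝ} (hγ : 1 < γ) (hL : 0 < L₀) :
    ∃ k I, IsTightSubarc f γ L₀ k I := by
  obtain ⟨_, ⟨a, rfl⟩, _, ⟨b, rfl⟩, hab⟩ := hf
  wlog hle : a ≤ b generalizing a b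
  · exact this b a hab.symm (le_of_not_ge hle)
  obtain ⟨k, hk⟩ := pow_unbounded_of_one_lt (L₀ / dist (f a) (f b)) hγ
  have hd := dist_pos.2 hab
  have hk' : lengthScale γ L₀ k ≤ dist (f a) (f b) := by
    rw [div_lt_iff₀ hd] at hk
    rw [lengthScale, div_le_iff₀ (by positivity)]
    linarith
  rw [← extendedCurve_coe f a, ← extendedCurve_coe f b] at hk'
  obtain ⟨I, hI, h1, h2⟩ := exists_isTightArc (continuous_extendedCurve f)
    (show (a : ℝ) ≤ b from hle) (lengthScale_pos (by linarith) hL k).le hk'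
  exact ⟨k, I, a.2.1.trans h1, h2.trans b.2.2, hI⟩

theorem StraightRunsSparse.le_dimH {f : C(unitInterval, EuclideanSpace ℝ (Fin d))}
    (hnt : (Set.range f).Nontrivial) {γ L₀ s : ℝ} {k₀ m : ℕ} (hL : 0 < L₀) (hm : 0 < m)
    (hγ : m < γ) (hs : γ ^ s = √((m : ℝ) * (m + 1))) (hf : StraightRunsSparse f γ L₀ k₀) :
    ENNReal.ofReal s ≤ dimH (Set.range f) := by
  classical
  have hm1 : (1 : ℝ) ≤ m := by exact_mod_cast hm
  have hγ1 : 1 < γ := by linarith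
  have hγ0 : 0 < γ := by linarith
  have hσ1 : 1 < √((m : ℝ) * (m + 1)) := by
    rw [Real.lt_sqrt zero_le_one]; nlinarith
  have hs0 : 0 < s := by
    by_contra! h
    have := Real.rpow_le_one_of_one_le_of_nonpos hγ1.le h
    linarith
  have hη := arcGap_pos hm hγ
  obtain ⟨k₁, I₀, hI₀⟩ := exists_isTightSubarc hnt hγ1 hL
  set σ := √((m : ℝ) * (m + 1)) with hσ
  set C := (m + 1 : ℝ) ^ k₁ * √((m + 1) / m) ^ k₀ with hC
  have hC0 : 0 < C := by positivity
  -- Halving turns the weak inequality `γ ^ q * ρ n ≤ Y` into the strict one required by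
  -- `weight_le_sum`.
  set Y := arcGap γ m * L₀ / 2 with hY
  have hY0 : 0 < Y := by positivity
  have hYs : 0 < Y ^ s := Real.rpow_pos_of_pos hY0 s
  by_contra! hdim
  -- The bound `κ` is chosen so that the cover carries total mass at most `C * σ / (C * σ + 1) < 1`,
  -- against mass 1 at the root.
  obtain ⟨T, U, ρ, hcov, hρ, hU, hsum⟩ := exists_finite_cover_of_dimH_lt
    (isCompact_range f.continuous) hs0 hdim (κ := Y ^ s / (C * σ + 1)) (by positivity)
  have hq : ∀ n, ∃ q : ℕ, n ∈ T → ρ n < arcGap γ m * lengthScale γ L₀ q ∧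
      σ⁻¹ ^ q ≤ σ * (ρ n ^ s / Y ^ s) := by
    intro n
    by_cases hn : n ∈ T
    swap; · exact ⟨0, fun h => (hn h).elim⟩
    have h1 : ρ n ^ s ≤ Y ^ s := by
      have := Finset.single_le_sum (f := fun n => ρ n ^ s)
        (fun i _ => Real.rpow_nonneg (hρ i).le s) hn
      have h2 : Y ^ s / (C * σ + 1) ≤ Y ^ s := div_le_self hYs.le (by nlinarith)
      linarith
    have h2 : ρ n ≤ Y := (Real.rpow_le_rpow_iff (hρ n).le hY0.le hs0).1 h1
    -- The level of a covering set: `γ ^ q ≤ Y / ρ n < γ ^ (q + 1)`. The upper bound, raised to the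
    -- power `s`, becomes a bound by `σ ^ (q + 1)` because `γ ^ s = σ`.
    obtain ⟨q, hq1, hq2⟩ := exists_nat_pow_near ((one_le_div (hρ n)).2 h2) hγ1
    refine ⟨q, fun _ => ⟨?_, ?_⟩⟩
    · rw [le_div_iff₀ (hρ n)] at hq1
      rw [lengthScale, mul_div_assoc', lt_div_iff₀ (by positivity)]
      have : γ ^ q * ρ n < 2 * Y := by linarith
      rw [hY] at this
      linarith
    · have h3 : Y ^ s / ρ n ^ s ≤ σ ^ (q + 1) := by
        rw [← hs, ← Real.rpow_natCast, ← Real.rpow_mul hγ0.le, mul_comm, Real.rpow_mul hγ0.le,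
          Real.rpow_natCast, ← Real.div_rpow hY0.le (hρ n).le]
        exact Real.rpow_le_rpow (by have := hρ n; positivity) hq2.le hs0.le
      have h4 : 0 < ρ n ^ s := Real.rpow_pos_of_pos (hρ n) s
      rw [div_le_iff₀ h4] at h3
      rw [inv_pow, inv_le_iff_one_le_mul₀ (by positivity), mul_div_assoc', div_mul_eq_mul_div,
        one_le_div hYs]
      calc Y ^ s ≤ _ := h3
        _ = _ := by ring
  choose q hq using hq
  have hmain := weight_le_sum (g := extendedCurve f) (Good := IsTightSubarc f γ L₀)
    (N := numSubarcs f γ L₀ m) (δ := fun k => arcGap γ m * lengthScale γ L₀ k)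
    (B := fun k => C * σ⁻¹ ^ k) (k₁ := k₁) (T := T) (U := U) (q := q) (K := T.sup q)
    (fun k I hI => hI.2.2.le)
    (fun k I => by unfold numSubarcs; split_ifs <;> omega)
    ((lengthScale_antitone hγ1 hL).const_mul hη.le)
    (fun i j hij => mul_le_mul_of_nonneg_left
      (pow_le_pow_of_le_one (by positivity) (inv_le_one_of_one_le₀ hσ1.le) hij) hC0.le)
    (fun k => by positivity)
    (fun k I hI => hI.exists_subarcs hm hγ hL)
    (fun k A hk hA => hf.prod_le hγ0 hL hm hk hA)
    (fun n hn x hx y hy => (hU n x hx y hy).trans_lt (hq n hn).1)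
    (fun k I hI => hcov ⟨_, rfl⟩)
    (fun n hn => Finset.le_sup hn) (T.sup q) k₁ (fun _ => I₀) le_rfl (by omega)
    ⟨fun i h1 h2 => by rwa [le_antisymm h2 h1], fun _ _ _ _ _ => ⟨le_rfl, le_rfl⟩⟩
  rw [Finset.Ico_self, Finset.prod_empty] at hmain
  refine absurd hmain (not_le.2 ?_)
  calc _ ≤ ∑ n ∈ T, C * σ⁻¹ ^ q n :=
        Finset.sum_le_sum_of_subset_of_nonneg (Finset.filter_subset _ _)
          fun _ _ _ => by positivity
    _ ≤ ∑ n ∈ T, C * (σ * (ρ n ^ s / Y ^ s)) :=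
        Finset.sum_le_sum fun n hn => mul_le_mul_of_nonneg_left (hq n hn).2 hC0.le
    _ = C * σ / Y ^ s * ∑ n ∈ T, ρ n ^ s := by
        rw [Finset.mul_sum]
        exact Finset.sum_congr rfl fun n _ => by ring
    _ < C * σ / Y ^ s * (Y ^ s / (C * σ + 1)) := mul_lt_mul_of_pos_left hsum (by positivity)
    _ < 1 := by
        rw [div_mul_div_cancel₀ hYs.ne', div_lt_one (by positivity)]
        linarith

end SparseRuns

theorem mainTheorem4 (d : ℕ) (f : C(unitInterval, EuclideanSpace ℝ (Fin d)))
    (hf : (Set.range f).Nontrivial) :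
    (∀ (γ L₀ : ℝ) (k₀ m : ℕ) (s : ℝ), 0 < L₀ → 0 < m → (m : ℝ) < γ →
      γ ^ s = √((m : ℝ) * ((m : ℝ) + 1)) →
      StraightRunsSparse f γ L₀ k₀ →
      ENNReal.ofReal s ≤ dimH (Set.range f)) ∧
    (∀ m : ℕ, 2 ≤ m →
      (∀ γ : ℝ, (m : ℝ) < γ → ∃ L₀ : ℝ, 0 < L₀ ∧ ∃ k₀ : ℕ, StraightRunsSparse f γ L₀ k₀) →
      ENNReal.ofReal (1 + Real.log (1 + 1 / (m : ℝ)) / (2 * Real.log (m : ℝ))) ≤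
        dimH (Set.range f)) := by
  refine ⟨fun γ L₀ k₀ m s hL hm hγ hs h => h.le_dimH hf hL hm hγ hs, fun m hm h => ?_⟩
  have hm2 : (2 : ℝ) ≤ m := by exact_mod_cast hm
  have hm0 : (m : ℝ) ≠ 0 := by positivity
  have hlog : 0 < Real.log m := Real.log_pos (by linarith)
  set σ := √((m : ℝ) * ((m : ℝ) + 1)) with hσ
  have hσ0 : 0 < σ := Real.sqrt_pos.2 (by positivity)
  have hlim : 1 + Real.log (1 + 1 / (m : ℝ)) / (2 * Real.log (m : ℝ)) =
      Real.log σ / Real.log m := by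
    have h1 : (1 : ℝ) + 1 / m = (m + 1) / m := by field_simp
    rw [hσ, Real.log_sqrt (by positivity), Real.log_mul hm0 (by positivity), h1,
      Real.log_div (by positivity) hm0]
    field_simp
    ring
  -- For each `γ > m` the first part gives the exponent `log σ / log γ`; the claim is its limit as
  -- `γ` decreases to `m`.
  have hcont : Filter.Tendsto (fun γ : ℝ => ENNReal.ofReal (Real.log σ / Real.log γ))
      (nhdsWithin (m : ℝ) (Set.Ioi m)) (nhds (ENNReal.ofReal (Real.log σ / Real.log m))) := by
    refine ENNReal.tendsto_ofReal (Filter.Tendsto.mono_left ?_ nhdsWithin_le_nhds)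
    exact tendsto_const_nhds.div (Real.continuousAt_log hm0) hlog.ne'
  rw [hlim]
  refine le_of_tendsto hcont (Filter.eventually_of_mem self_mem_nhdsWithin fun γ hγ => ?_)
  have hγ : (m : ℝ) < γ := hγ
  obtain ⟨L₀, hL, k₀, hsp⟩ := h γ hγ
  have hlogγ : 0 < Real.log γ := Real.log_pos (by linarith)
  refine hsp.le_dimH hf hL (by omega) hγ ?_
  rw [Real.rpow_def_of_pos (by linarith), mul_div_cancel₀ _ hlogγ.ne', Real.exp_log hσ0]
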